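/- Call a topological group Polish if its topology is separable and completely metrizable, and call a Polish group $G$ algebraically determined if every abstract group isomorphism $\varphi : L \to G$ from a Polish group $L$ onto $G$ is a topological isomorphism (that is, also a homeomorphism). Let $n \ge 2$ and let $G(n)$ be one of the following groups of real $n \times n$ matrices: $GL(n,\mathbb{R}) = \{A : \det A \ne 0\}$, $SL(n,\mathbb{R}) = \{A : \det A = 1\}$, $|SL(n,\mathbb{R})| = \{A : |\det A| = 1\}$, or $GL^{+}(n,\mathbb{R}) = \{A : \det A > 0\}$, with its usual topology. Let $\mathbb{R}^n \rtimes G(n)$ be the natural semidirect product, that is, the set $\mathbb{R}^n \times G(n)$ with the multiplication $(x,A)(y,B) = (x + Ay, AB)$ and the product topology. Then every abstract group isomorphism $\varphi : L \to \mathbb{R}^n \rtimes G(n)$ from a Polish group $L$ onto $\mathbb{R}^n \rtimes G(n)$ is a topological isomorphism. Consequently $\mathbb{R}^n \rtimes G(n)$ is an algebraically determined Polish group. -/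

import Mathlib

open Matrix

universe u v

/-- The semidirect product of two topological groups carries the product topology, i.e. the
topology transported from `N × G` along the bijection `x ↦ (x.left, x.right)`. -/
instance SemidirectProduct.instTopologicalSpace {N G : Type*} [Group N] [Group G]
    [TopologicalSpace N] [TopologicalSpace G] (θ : G →* MulAut N) :
    TopologicalSpace (N ⋊[θ] G) :=
  TopologicalSpace.induced (fun x => (x.left, x.right)) instTopologicalSpaceProd

/-- A Polish group: a topological group whose topology is separable and completely metrizable. -/
structure IsPolishGroup (G : Type*) [Group G] [TopologicalSpace G] : Prop where
  isTopologicalGroup : IsTopologicalGroup G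
  polishSpace : PolishSpace G

/-- An algebraically determined Polish group: a Polish group `G` such that every abstract group
isomorphism from a Polish group `L` onto `G` is a homeomorphism. -/
structure IsAlgebraicallyDetermined (G : Type v) [Group G] [TopologicalSpace G] : Prop where
  isPolishGroup : IsPolishGroup G
  isHomeomorph : ∀ (L : Type u) [Group L] [TopologicalSpace L], IsPolishGroup L →
    ∀ φ : L ≃* G, IsHomeomorph φ

/-- `SL(n, ℝ)`, as a subgroup of `GL(n, ℝ)`. -/
def specialLinearSubgroup (n : ℕ) : Subgroup (GL (Fin n) ℝ) where
  carrier := {A | (A : Matrix (Fin n) (Fin n) ℝ).det = 1}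
  one_mem' := by simp
  mul_mem' {A B} hA hB := by
    simp only [Set.mem_ofPred_eq] at hA hB ⊢
    rw [Units.val_mul, det_mul, hA, hB, one_mul]
  inv_mem' {A} hA := by
    simp only [Set.mem_ofPred_eq] at hA ⊢
    rw [coe_units_inv, det_nonsing_inv, hA, Ring.inverse_one]

/-- `|SL(n, ℝ)|`: the matrices in `GL(n, ℝ)` whose determinant has absolute value one. -/
def absSpecialLinearSubgroup (n : ℕ) : Subgroup (GL (Fin n) ℝ) where
  carrier := {A | |(A : Matrix (Fin n) (Fin n) ℝ).det| = 1}
  one_mem' := by simp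
  mul_mem' {A B} hA hB := by
    simp only [Set.mem_ofPred_eq] at hA hB ⊢
    rw [Units.val_mul, det_mul, abs_mul, hA, hB, one_mul]
  inv_mem' {A} hA := by
    simp only [Set.mem_ofPred_eq] at hA ⊢
    rw [coe_units_inv, det_nonsing_inv, Ring.inverse_eq_inv', abs_inv, hA, inv_one]

/-- The natural action of `GL(n, ℝ)` on the additive group `ℝⁿ` (written multiplicatively, as the
semidirect product requires): `A` sends the vector `x` to `A x`. -/
def naturalAction (n : ℕ) : GL (Fin n) ℝ →* MulAut (Multiplicative (Fin n → ℝ)) where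
  toFun A :=
    { toFun := fun x => Multiplicative.ofAdd
        ((A : Matrix (Fin n) (Fin n) ℝ) *ᵥ Multiplicative.toAdd x)
      invFun := fun x => Multiplicative.ofAdd
        (((A⁻¹ : GL (Fin n) ℝ) : Matrix (Fin n) (Fin n) ℝ) *ᵥ Multiplicative.toAdd x)
      left_inv := fun x => by
        dsimp only
        rw [toAdd_ofAdd, mulVec_mulVec, ← Units.val_mul, inv_mul_cancel, Units.val_one,
          one_mulVec, ofAdd_toAdd]
      right_inv := fun x => by
        dsimp only
        rw [toAdd_ofAdd, mulVec_mulVec, ← Units.val_mul, mul_inv_cancel, Units.val_one,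
          one_mulVec, ofAdd_toAdd]
      map_mul' := fun x y => by rw [toAdd_mul, mulVec_add, ofAdd_add] }
  map_one' := by
    ext1 x
    exact congrArg Multiplicative.ofAdd (one_mulVec (Multiplicative.toAdd x))
  map_mul' A B := by
    ext1 x
    exact congrArg Multiplicative.ofAdd
      (mulVec_mulVec (Multiplicative.toAdd x) (A : Matrix (Fin n) (Fin n) ℝ)
        (B : Matrix (Fin n) (Fin n) ℝ)).symm

/-- The natural semidirect product `ℝⁿ ⋊ G` for a subgroup `G` of `GL(n, ℝ)`: pairs `(x, A)` with
`(x, A) (y, B) = (x + A y, A B)`, with the product topology, `G` having the subspace topology. -/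
abbrev NaturalSemidirectProduct (n : ℕ) (G : Subgroup (GL (Fin n) ℝ)) : Type :=
  Multiplicative (Fin n → ℝ) ⋊[(naturalAction n).comp G.subtype] G

section

open MeasureTheory Topology Pointwise Set

/-! It suffices that `φ` is Borel. Then `φ.symm` is Borel by Lusin–Souslin, hence continuous because
the target is locally compact, hence open by the open mapping theorem.

Borel measurability comes from describing subsets of ℝⁿ ⋊ G in group terms. Centralizers pull back
to closed sets; products, images under word maps and generated submonoids of sets with analytic
preimage again have analytic preimage; and a set that is analytic together with its complement is
Borel (Suslin). The translations, the diagonal torus and the coordinate hyperplanes are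
centralizers. The order of ℝ is algebraic, the positive reals being the nonzero squares, so
half-spaces of translations have analytic preimages (`halfSpace_eq`), in fact Borel ones. The linear
part is generated by the torus and finitely many transvections (`linearPart_eq_closure`).
Multiplying half-spaces by it controls the coordinates of the vector part; conjugating basis
translations reads off the matrix entries. -/

/-! ### Analytic sets, and pulling algebraic constructions back along an isomorphism. -/

theorem MeasureTheory.AnalyticSet.mul {M : Type*} [TopologicalSpace M] [Mul M] [ContinuousMul M]
    {s t : Set M} (hs : AnalyticSet s) (ht : AnalyticSet t) : AnalyticSet (s * t) := by
  obtain ⟨β, _, _, f, hf, rfl⟩ := analyticSet_iff_exists_polishSpace_range.1 hs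
  obtain ⟨γ, _, _, g, hg, rfl⟩ := analyticSet_iff_exists_polishSpace_range.1 ht
  have h : range f * range g = range fun p : β × γ => f p.1 * g p.2 := by
    ext x
    simp [Set.mem_mul]
  rw [h]
  exact analyticSet_range_of_polishSpace (by fun_prop)

theorem MeasureTheory.AnalyticSet.union {X : Type*} [TopologicalSpace X] {s t : Set X}
    (hs : AnalyticSet s) (ht : AnalyticSet t) : AnalyticSet (s ∪ t) := by
  rw [union_eq_iUnion]
  exact AnalyticSet.iUnion (Bool.rec ht hs)

theorem Submonoid.coe_closure_eq_iUnion_pow {M : Type*} [Monoid M] (s : Set M) :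
    (Submonoid.closure s : Set M) = ⋃ m : ℕ, s ^ m := by
  ext x
  rw [mem_iUnion]
  constructor
  · intro hx
    induction hx using Submonoid.closure_induction with
    | mem x hx => exact ⟨1, by simpa using hx⟩
    | one => exact ⟨0, by simp⟩
    | mul x y _ _ hx hy =>
      obtain ⟨a, ha⟩ := hx
      obtain ⟨b, hb⟩ := hy
      exact ⟨a + b, pow_add s a b ▸ mul_mem_mul ha hb⟩
  · rintro ⟨m, hm⟩
    induction m generalizing x with
    | zero => simp_all
    | succ m ih =>
      rw [pow_succ] at hm
      obtain ⟨a, ha, b, hb, rfl⟩ := hm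
      exact mul_mem (ih a ha) (Submonoid.subset_closure hb)

theorem MeasureTheory.AnalyticSet.submonoid_closure {M : Type*} [TopologicalSpace M] [T1Space M]
    [PolishSpace M] [Monoid M] [ContinuousMul M] {s : Set M} (hs : AnalyticSet s) :
    AnalyticSet (Submonoid.closure s : Set M) := by
  rw [Submonoid.coe_closure_eq_iUnion_pow]
  refine AnalyticSet.iUnion fun m => ?_
  induction m with
  | zero => exact (isClosed_singleton (x := (1 : M))).analyticSet
  | succ m ih => simpa [pow_succ] using ih.mul hs

theorem MulEquiv.preimage_mul_set {M N : Type*} [Mul M] [Mul N] (φ : M ≃* N) (s t : Set N) :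
    φ ⁻¹' (s * t) = φ ⁻¹' s * φ ⁻¹' t := by
  have h : ∀ s : Set N, φ ⁻¹' s = φ.symm '' s := fun s => (φ.toEquiv.image_symm_eq_preimage s).symm
  simp only [h, image_mul]

theorem MulEquiv.preimage_submonoid_closure {M N : Type*} [Monoid M] [Monoid N] (φ : M ≃* N)
    (s : Set N) :
    φ ⁻¹' (Submonoid.closure s : Set N) = (Submonoid.closure (φ ⁻¹' s) : Set M) := by
  have h : ∀ s : Set N, φ ⁻¹' s = φ.symm '' s := fun s => (φ.toEquiv.image_symm_eq_preimage s).symm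
  rw [h, h s]
  exact congrArg SetLike.coe (MonoidHom.map_mclosure φ.symm.toMonoidHom s)

/-- The preimage of a centralizer under a group isomorphism from a Hausdorff group is closed. -/
theorem MulEquiv.isClosed_preimage_centralizer {L P : Type*} [Group L] [TopologicalSpace L]
    [ContinuousMul L] [T2Space L] [Group P] (φ : L ≃* P) (s : Set P) :
    IsClosed (φ ⁻¹' s.centralizer) := by
  have h : φ ⁻¹' s.centralizer = ⋂ p ∈ s, {l : L | φ.symm p * l = l * φ.symm p} := by
    ext l
    simp only [mem_preimage, Set.mem_centralizer_iff, mem_iInter, mem_ofPred_eq]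
    refine forall₂_congr fun p _ => ?_
    rw [← φ.injective.eq_iff]
    simp
  rw [h]
  exact isClosed_biInter fun p _ => isClosed_eq (by fun_prop) (by fun_prop)

/-! ### Automatic continuity. -/

/-- A Borel homomorphism from a locally compact second countable group to a second countable group
is continuous. -/
theorem MonoidHom.continuous_of_measurable_of_locallyCompact {P L : Type*} [Group P]
    [TopologicalSpace P] [IsTopologicalGroup P] [LocallyCompactSpace P]
    [SecondCountableTopology P] [MeasurableSpace P] [BorelSpace P] [Group L] [TopologicalSpace L]
    [IsTopologicalGroup L] [SecondCountableTopology L] [MeasurableSpace L] [OpensMeasurableSpace L]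
    (f : P →* L) (hf : Measurable f) : Continuous f := by
  refine continuous_of_continuousAt_one f ?_
  rw [ContinuousAt, map_one]
  intro U hU
  obtain ⟨V', hV', hVU⟩ := exists_nhds_split_inv hU
  obtain ⟨V, hV, hVo, hV1⟩ := mem_nhds_iff.1 hV'
  obtain ⟨D, hD, hDd⟩ := TopologicalSpace.exists_countable_dense L
  have := hD.to_subtype
  let S : D → Set P := fun d => f ⁻¹' {y | y / (d : L) ∈ V}
  have hcover : ⋃ d, S d = univ := by
    refine eq_univ_of_forall fun x => mem_iUnion.2 ?_
    obtain ⟨d, hdV, hd⟩ := hDd.inter_open_nonempty {d | f x / d ∈ V}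
      (hVo.preimage (continuous_const.div' continuous_id)) ⟨f x, by simpa using hV1⟩
    exact ⟨⟨d, hd⟩, hdV⟩
  -- Countably many sets `S d` cover the group, so one has positive Haar measure; by Steinhaus its
  -- difference set is a neighbourhood of 1, and `f` maps it into `U`.
  obtain ⟨d, hd⟩ : ∃ d, 0 < Measure.haar (S d) := by
    by_contra! h
    have h0 : Measure.haar (⋃ d, S d) = 0 := measure_iUnion_null fun d => nonpos_iff_eq_zero.1 (h d)
    rw [hcover] at h0
    exact (isOpen_univ.measure_pos Measure.haar (univ_nonempty (α := P))).ne' h0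
  have hSm : MeasurableSet (S d) :=
    hf (hVo.preimage (continuous_id.div' continuous_const)).measurableSet
  refine Filter.mem_map.2 (Filter.mem_of_superset
    (Measure.div_mem_nhds_one_of_haar_pos Measure.haar (S d) hSm hd) fun z hz => ?_)
  obtain ⟨x, hx, y, hy, rfl⟩ := hz
  have h := hVU _ (hV hx) _ (hV hy)
  simpa using h

/-- A Borel isomorphism of groups from a Polish group to a locally compact Polish group is a
homeomorphism. -/
theorem MulEquiv.isHomeomorph_of_measurable {L P : Type*} [Group L] [TopologicalSpace L]
    [IsTopologicalGroup L] [PolishSpace L] [MeasurableSpace L] [BorelSpace L] [Group P]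
    [TopologicalSpace P] [IsTopologicalGroup P] [PolishSpace P] [LocallyCompactSpace P]
    [MeasurableSpace P] [BorelSpace P] (φ : L ≃* P) (hφ : Measurable φ) : IsHomeomorph φ := by
  have hsymm : Measurable φ.symm := fun s hs => by
    rw [show φ.symm ⁻¹' s = φ '' s from (φ.toEquiv.image_eq_preimage_symm s).symm]
    exact (hφ.measurableEmbedding φ.injective).measurableSet_image' hs
  have hc : Continuous φ.symm :=
    MonoidHom.continuous_of_measurable_of_locallyCompact φ.symm.toMonoidHom hsymm
  have ho : IsOpenMap φ.symm :=
    MonoidHom.isOpenMap_of_sigmaCompact φ.symm.toMonoidHom φ.symm.surjective hc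
  exact (φ.symm.toEquiv.toHomeomorphOfContinuousOpen hc ho).symm.isHomeomorph

/-! ### Group-theoretic descriptions of subsets of ℝⁿ ⋊ G. -/

namespace NaturalSemidirectProduct

variable {n : ℕ} {G : Subgroup (GL (Fin n) ℝ)}

/-- The translation part of an element of `ℝⁿ ⋊ G`. -/
def vec (p : NaturalSemidirectProduct n G) : Fin n → ℝ := p.left.toAdd

/-- The linear part of an element of `ℝⁿ ⋊ G`. -/
def mat (p : NaturalSemidirectProduct n G) : Matrix (Fin n) (Fin n) ℝ := p.right.1.1

/-- The translation by `v`. -/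
def trans (v : Fin n → ℝ) : NaturalSemidirectProduct n G :=
  SemidirectProduct.inl (Multiplicative.ofAdd v)

/-- `SL(n, ℝ)` inside `ℝⁿ ⋊ G`, when `G` contains it. -/
def ofSL (hG : specialLinearSubgroup n ≤ G) (A : SpecialLinearGroup (Fin n) ℝ) :
    NaturalSemidirectProduct n G :=
  SemidirectProduct.inr ⟨A.toGL, hG A.2⟩

theorem eq_of_vec_mat {p q : NaturalSemidirectProduct n G} (h : vec p = vec q)
    (h' : mat p = mat q) : p = q :=
  SemidirectProduct.ext h (Subtype.ext (Units.ext h'))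

@[simp] theorem vec_mul (p q : NaturalSemidirectProduct n G) :
    vec (p * q) = vec p + mat p *ᵥ vec q := rfl

@[simp] theorem mat_mul (p q : NaturalSemidirectProduct n G) : mat (p * q) = mat p * mat q := rfl

@[simp] theorem vec_one : vec (1 : NaturalSemidirectProduct n G) = 0 := rfl

@[simp] theorem mat_one : mat (1 : NaturalSemidirectProduct n G) = 1 := rfl

@[simp] theorem vec_trans (v : Fin n → ℝ) : vec (trans v : NaturalSemidirectProduct n G) = v := rfl

@[simp] theorem mat_trans (v : Fin n → ℝ) : mat (trans v : NaturalSemidirectProduct n G) = 1 := rfl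

@[simp] theorem vec_ofSL (hG : specialLinearSubgroup n ≤ G) (A : SpecialLinearGroup (Fin n) ℝ) :
    vec (ofSL hG A) = 0 := rfl

@[simp] theorem mat_ofSL (hG : specialLinearSubgroup n ≤ G) (A : SpecialLinearGroup (Fin n) ℝ) :
    mat (ofSL hG A) = A.1 := rfl

theorem mat_ofSL_transvection (hG : specialLinearSubgroup n ≤ G) {i j : Fin n} (hij : i ≠ j)
    (c : ℝ) : mat (ofSL hG (SpecialLinearGroup.transvection hij c)) = transvection i j c := rfl

theorem mat_mul_mat_inv (p : NaturalSemidirectProduct n G) : mat p * mat p⁻¹ = 1 := by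
  rw [← mat_mul, mul_inv_cancel, mat_one]

theorem mat_inv_mul_mat (p : NaturalSemidirectProduct n G) : mat p⁻¹ * mat p = 1 := by
  rw [← mat_mul, inv_mul_cancel, mat_one]

theorem vec_inv (p : NaturalSemidirectProduct n G) : vec p⁻¹ = -(mat p⁻¹ *ᵥ vec p) := by
  have h := vec_mul p⁻¹ p
  rw [inv_mul_cancel, vec_one] at h
  exact eq_neg_of_add_eq_zero_left h.symm

theorem conj_trans (p : NaturalSemidirectProduct n G) (v : Fin n → ℝ) :
    p * trans v * p⁻¹ = trans (mat p *ᵥ v) := by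
  rw [mul_inv_eq_iff_eq_mul]
  exact eq_of_vec_mat (by simp [add_comm]) (by simp)

variable (n G) in
/-- The subgroup of translations. -/
def translations : Set (NaturalSemidirectProduct n G) := {p | mat p = 1}

variable (n G) in
/-- The subgroup of diagonal linear maps. -/
def torus : Set (NaturalSemidirectProduct n G) := {p | vec p = 0 ∧ (mat p).IsDiag}

variable (n G) in
/-- The subgroup `G` of `ℝⁿ ⋊ G`. -/
def linearPart : Set (NaturalSemidirectProduct n G) := {p | vec p = 0}

variable (G) in
/-- The translations by vectors with vanishing `i`-th coordinate. -/
def hyperplane (i : Fin n) : Set (NaturalSemidirectProduct n G) := {p | mat p = 1 ∧ vec p i = 0}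

variable (G) in
/-- The translations by vectors with `i`-th coordinate larger than `c`. -/
def halfSpace (i : Fin n) (c : ℝ) : Set (NaturalSemidirectProduct n G) :=
  {p | mat p = 1 ∧ c < vec p i}

theorem ofSL_diag2n_mem_torus (hG : specialLinearSubgroup n ≤ G) {i j : Fin n} (hij : i ≠ j)
    {a : ℝ} (ha : a ≠ 0) : ofSL hG (SpecialLinearGroup.diag2n hij a ha) ∈ torus n G :=
  ⟨rfl, by rw [mat_ofSL, SpecialLinearGroup.diag2n_coe]; exact isDiag_diagonal _⟩

theorem translations_eq_centralizer : translations n G = (translations n G).centralizer := by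
  ext p
  rw [Set.mem_centralizer_iff]
  constructor
  · intro hp q hq
    have hp : mat p = 1 := hp
    have hq : mat q = 1 := hq
    exact eq_of_vec_mat (by simp [hp, hq, add_comm]) (by simp [hp, hq])
  · intro h
    refine ext_iff_mulVec.2 fun v => ?_
    have := congrArg vec (h (trans v) rfl)
    simp only [vec_mul, vec_trans, mat_trans, one_mulVec] at this ⊢
    rw [add_comm] at this
    exact (add_left_cancel this).symm

/-- Testing against the determinant-one matrix with entries 2 and 1/2 at two places suffices: 2 ≠ 1
kills the vector part, 2 ≠ 1/2 the off-diagonal entries. -/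
theorem torus_eq_centralizer (hn : 2 ≤ n) (hG : specialLinearSubgroup n ≤ G) :
    torus n G = (torus n G).centralizer := by
  ext p
  rw [Set.mem_centralizer_iff]
  constructor
  · rintro ⟨hp, hp'⟩ q ⟨hq, hq'⟩
    refine eq_of_vec_mat (by simp [hp, hq]) ?_
    rw [mat_mul, mat_mul, ← hp'.diagonal_diag, ← hq'.diagonal_diag, diagonal_mul_diagonal,
      diagonal_mul_diagonal]
    simp only [mul_comm]
  · intro h
    have : Nontrivial (Fin n) := Fin.nontrivial_iff_two_le.2 hn
    constructor
    · ext i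
      obtain ⟨j, hij⟩ := exists_ne i
      have h2 := congrFun (congrArg vec (h _ (ofSL_diag2n_mem_torus hG hij.symm two_ne_zero))) i
      simp [SpecialLinearGroup.diag2n_coe, mulVec_diagonal] at h2
      simp only [Pi.zero_apply]
      linarith
    · intro i j hij
      have h2 := congrFun₂ (congrArg mat (h _ (ofSL_diag2n_mem_torus hG hij two_ne_zero))) i j
      simp [SpecialLinearGroup.diag2n_coe, hij.symm] at h2
      linarith

/-- The transvection adds coordinate `i` to coordinate `k`, so it fixes exactly the vectors whose
`i`-th coordinate is zero. -/
theorem hyperplane_eq_centralizer (hG : specialLinearSubgroup n ≤ G) {i k : Fin n} (hik : k ≠ i) :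
    hyperplane G i = (translations n G ∪
      {ofSL hG (SpecialLinearGroup.transvection hik 1)}).centralizer := by
  rw [Set.centralizer_union, ← translations_eq_centralizer]
  ext p
  have hvec : (transvection k i (1 : ℝ)) *ᵥ vec p = vec p + Pi.single k (vec p i) := by
    ext l
    by_cases hl : l = k <;> simp [transvection, add_mulVec, hl, single_mulVec]
  constructor
  · rintro ⟨hp, hpi⟩
    refine ⟨hp, ?_⟩
    rw [Set.mem_centralizer_iff]
    rintro _ rfl
    refine eq_of_vec_mat ?_ (by simp [hp])
    simp [hp, mat_ofSL_transvection, hvec, hpi, -mat_ofSL]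
  · rintro ⟨hp, h⟩
    refine ⟨hp, ?_⟩
    have h2 := congrFun (congrArg vec (h _ rfl)) k
    have hp : mat p = 1 := hp
    simpa [mat_ofSL_transvection, hvec, -mat_ofSL] using h2

/-- Conjugation by `t * t` multiplies the `i`-th basis vector by the square of a diagonal entry,
which runs through all positive reals; the hyperplane supplies the other coordinates. -/
theorem halfSpace_eq (hn : 2 ≤ n) (hG : specialLinearSubgroup n ≤ G) (i : Fin n) (c : ℝ) :
    halfSpace G i c = {trans (Pi.single i c)} *
      ((fun t => t * t * trans (Pi.single i 1) * (t * t)⁻¹) '' torus n G) * hyperplane G i := by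
  have : Nontrivial (Fin n) := Fin.nontrivial_iff_two_le.2 hn
  obtain ⟨j, hij⟩ := exists_ne i
  ext p
  simp only [Set.mem_mul, mem_singleton_iff, mem_image, exists_exists_and_eq_and, exists_eq_left,
    conj_trans]
  constructor
  · rintro ⟨hp, hc⟩
    have hr : 0 < vec p i - c := sub_pos.2 hc
    have hs : √(vec p i - c) ≠ 0 := (Real.sqrt_pos.2 hr).ne'
    refine ⟨_, ofSL_diag2n_mem_torus hG hij.symm hs, trans (vec p - Pi.single i (vec p i)),
      ⟨rfl, by simp⟩, ?_⟩
    refine eq_of_vec_mat ?_ (by simp [hp])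
    ext k
    by_cases hk : k = i
    · subst hk
      simp [SpecialLinearGroup.diag2n_coe, Real.mul_self_sqrt hr.le]
    · simp [SpecialLinearGroup.diag2n_coe, hk]
  · rintro ⟨t, ht, q, ⟨hq, hqi⟩, rfl⟩
    refine ⟨by simp [hq], ?_⟩
    have hd := mat_mul_mat_inv t
    have h0 : mat t i i ≠ 0 := by
      intro h0
      have := congrFun₂ hd i i
      rw [← ht.2.diagonal_diag] at this
      simp [h0] at this
    rw [mat_mul, ← ht.2.diagonal_diag]
    simp [hqi, h0]

/-- Diagonal maps and elementary transvections generate `G`. -/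
theorem linearPart_eq_closure (hG : specialLinearSubgroup n ≤ G) :
    linearPart n G = Submonoid.closure (torus n G ∪
      range fun t : {k : Fin n × Fin n // k.1 ≠ k.2} × ℤˣ =>
        ofSL hG (SpecialLinearGroup.transvection t.1.2 ((t.2 : ℤ) : ℝ))) := by
  refine Subset.antisymm ?_ ?_
  · set K := Submonoid.closure (torus n G ∪
      range fun t : {k : Fin n × Fin n // k.1 ≠ k.2} × ℤˣ =>
        ofSL hG (SpecialLinearGroup.transvection t.1.2 ((t.2 : ℤ) : ℝ))) with hK
    have htr : ∀ t : TransvectionStruct (Fin n) ℝ, ofSL hG t.toSpecialLinearGroup ∈ K := by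
      rintro ⟨i, j, hij, c⟩
      rcases eq_or_ne c 0 with rfl | hc
      · convert K.one_mem
        exact eq_of_vec_mat (by simp) (by simp)
      -- Conjugating by the diagonal matrix with entries √|c| and 1/√|c| scales the transvection
      -- parameter by |c| > 0, so the parameters ±1 yield all others.
      obtain ⟨ε, hε⟩ : ∃ ε : ℤˣ, ((ε : ℤ) : ℝ) * |c| = c := by
        rcases le_total 0 c with h | h
        · exact ⟨1, by simp [abs_of_nonneg h]⟩
        · exact ⟨-1, by simp [abs_of_nonpos h]⟩
      have hs : √|c| ≠ 0 := (Real.sqrt_pos.2 (abs_pos.2 hc)).ne'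
      have hT : ∀ {a : ℝ} (ha : a ≠ 0), ofSL hG (SpecialLinearGroup.diag2n hij a ha) ∈ K :=
        fun ha => Submonoid.subset_closure (Or.inl (ofSL_diag2n_mem_torus hG hij ha))
      have hE : ofSL hG (SpecialLinearGroup.transvection hij ((ε : ℤ) : ℝ)) ∈ K :=
        Submonoid.subset_closure (Or.inr ⟨(⟨(i, j), hij⟩, ε), rfl⟩)
      convert K.mul_mem (K.mul_mem (hT hs) hE) (hT (inv_ne_zero hs))
      refine eq_of_vec_mat (by simp) ?_
      rw [mat_mul, mat_mul, TransvectionStruct.toSpecialLinearGroup_mk, mat_ofSL_transvection,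
        mat_ofSL_transvection, mat_ofSL, mat_ofSL, SpecialLinearGroup.diag2n_coe,
        SpecialLinearGroup.diag2n_coe]
      ext a b
      rw [mul_diagonal, diagonal_mul]
      simp only [transvection, Matrix.add_apply, Matrix.one_apply, Matrix.single_apply]
      have hss : √|c| * √|c| = |c| := Real.mul_self_sqrt (abs_nonneg c)
      by_cases hai : a = i
      · by_cases hbj : b = j
        · have hc' : c = √|c| * ((ε : ℤ) : ℝ) * √|c| := by
            rw [mul_right_comm, hss, mul_comm, hε]
          simpa [hai, hbj, hij, hij.symm] using hc'
        · by_cases hba : b = i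
          · simp [hai, hba, hij.symm, hs]
          · simp [hai, Ne.symm hbj, Ne.symm hba]
      · by_cases hab : a = b
        · subst hab
          by_cases haj : a = j <;> simp [hai, haj, hs, hij, hij.symm, Ne.symm hai]
        · simp [hab, Ne.symm hai]
    have hlist : ∀ l : List (TransvectionStruct (Fin n) ℝ), ∃ B ∈ K, B ∈ linearPart n G ∧
        B⁻¹ ∈ linearPart n G ∧ mat B = (l.map TransvectionStruct.toMatrix).prod := by
      intro l
      refine ⟨ofSL hG (l.map TransvectionStruct.toSpecialLinearGroup).prod, ?_, rfl, ?_, ?_⟩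
      · induction l with
        | nil =>
          convert K.one_mem
          exact eq_of_vec_mat (by simp) (by simp)
        | cons t l ih =>
          convert K.mul_mem (htr t) ih
          exact eq_of_vec_mat (by simp) (by simp)
      · simp [linearPart, vec_inv]
      · rw [mat_ofSL]
        induction l with
        | nil => simp
        | cons t l ih => simp [ih]
    intro p hp
    have hp : vec p = 0 := hp
    obtain ⟨l, l', D, h⟩ := Pivot.exists_list_transvec_mul_diagonal_mul_list_transvec (mat p)
    obtain ⟨B, hBK, hB, hB', hl⟩ := hlist l
    obtain ⟨C, hCK, hC, hC', hl'⟩ := hlist l'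
    have hB : vec B = 0 := hB
    have hB' : vec B⁻¹ = 0 := hB'
    have hC' : vec C⁻¹ = 0 := hC'
    -- The diagonal factor of the pivot decomposition lies in `G`, since the transvection products
    -- `B` and `C` do.
    have hD : B⁻¹ * p * C⁻¹ ∈ torus n G := by
      refine ⟨by simp [hB', hp, hC'], ?_⟩
      have : mat (B⁻¹ * p * C⁻¹) = diagonal D := by
        rw [mat_mul, mat_mul, h, ← hl, ← hl', ← Matrix.mul_assoc, ← Matrix.mul_assoc,
          mat_inv_mul_mat, Matrix.one_mul, Matrix.mul_assoc, mat_mul_mat_inv, Matrix.mul_one]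
      rw [this]
      exact isDiag_diagonal D
    have h3 : p = B * (B⁻¹ * p * C⁻¹) * C := by group
    rw [h3]
    exact K.mul_mem (K.mul_mem hBK (Submonoid.subset_closure (Or.inl hD))) hCK
  · intro p hp
    induction hp using Submonoid.closure_induction with
    | mem x hx =>
      rcases hx with hx | ⟨t, rfl⟩
      · exact hx.1
      · rfl
    | one => rfl
    | mul x y _ _ hx hy =>
      have hx : vec x = 0 := hx
      have hy : vec y = 0 := hy
      simp [linearPart, hx, hy]

end NaturalSemidirectProduct

theorem MulEquiv.analyticSet_preimage_singleton {L P : Type*} [TopologicalSpace L] [PolishSpace L]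
    [Mul L] [Mul P] (φ : L ≃* P) (p : P) : AnalyticSet (φ ⁻¹' {p}) :=
  ((finite_singleton p).preimage φ.injective.injOn).isClosed.analyticSet

namespace NaturalSemidirectProduct

variable {n : ℕ} {G : Subgroup (GL (Fin n) ℝ)}

/-! ### Borel measurability of the coordinates of `φ`. -/

section Borel

variable {L : Type u} [Group L] [TopologicalSpace L] [IsTopologicalGroup L] [PolishSpace L]
  (φ : L ≃* NaturalSemidirectProduct n G)

theorem isClosed_preimage_translations : IsClosed (φ ⁻¹' translations n G) := by
  rw [translations_eq_centralizer]
  exact φ.isClosed_preimage_centralizer _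

theorem isClosed_preimage_torus (hn : 2 ≤ n) (hG : specialLinearSubgroup n ≤ G) :
    IsClosed (φ ⁻¹' torus n G) := by
  rw [torus_eq_centralizer hn hG]
  exact φ.isClosed_preimage_centralizer _

theorem isClosed_preimage_hyperplane (hn : 2 ≤ n) (hG : specialLinearSubgroup n ≤ G) (i : Fin n) :
    IsClosed (φ ⁻¹' hyperplane G i) := by
  have : Nontrivial (Fin n) := Fin.nontrivial_iff_two_le.2 hn
  obtain ⟨k, hk⟩ := exists_ne i
  rw [hyperplane_eq_centralizer hG hk]
  exact φ.isClosed_preimage_centralizer _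

theorem analyticSet_preimage_halfSpace (hn : 2 ≤ n) (hG : specialLinearSubgroup n ≤ G) (i : Fin n)
    (c : ℝ) : AnalyticSet (φ ⁻¹' halfSpace G i c) := by
  rw [halfSpace_eq hn hG, φ.preimage_mul_set, φ.preimage_mul_set]
  refine ((φ.analyticSet_preimage_singleton _).mul ?_).mul
    (isClosed_preimage_hyperplane φ hn hG i).analyticSet
  have h : φ ⁻¹' ((fun t => t * t * trans (Pi.single i 1) * (t * t)⁻¹) '' torus n G) =
      (fun l => l * l * φ.symm (trans (Pi.single i 1)) * (l * l)⁻¹) '' (φ ⁻¹' torus n G) := by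
    ext l
    constructor
    · rintro ⟨t, ht, h⟩
      refine ⟨φ.symm t, by simpa using ht, φ.injective ?_⟩
      simpa using h
    · rintro ⟨m, hm, rfl⟩
      exact ⟨φ m, hm, by simp⟩
  rw [h]
  exact (isClosed_preimage_torus φ hn hG).analyticSet.image_of_continuous (by fun_prop)

theorem measurableSet_preimage_halfSpace [MeasurableSpace L] [BorelSpace L] (hn : 2 ≤ n)
    (hG : specialLinearSubgroup n ≤ G) (i : Fin n) (c : ℝ) :
    MeasurableSet (φ ⁻¹' halfSpace G i c) := by
  refine (analyticSet_preimage_halfSpace φ hn hG i c).measurableSet_of_compl ?_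
  -- The complement consists of the non-translations, the opposite open half-space (inverses of the
  -- one at `-c`) and the bounding hyperplane, all with analytic preimage.
  have h : (φ ⁻¹' halfSpace G i c)ᶜ = (φ ⁻¹' translations n G)ᶜ ∪
      (Inv.inv '' (φ ⁻¹' halfSpace G i (-c)) ∪
        φ ⁻¹' ({trans (Pi.single i c)} * hyperplane G i)) := by
    ext l
    have hneg : l ∈ Inv.inv '' (φ ⁻¹' halfSpace G i (-c)) ↔ mat (φ l) = 1 ∧ vec (φ l) i < c := by
      rw [image_inv_eq_inv, Set.mem_inv, mem_preimage, map_inv]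
      constructor
      · rintro ⟨h1, h2⟩
        have h3 := mat_mul_mat_inv (φ l)
        rw [h1, Matrix.mul_one] at h3
        rw [vec_inv, h1] at h2
        exact ⟨h3, by simpa using h2⟩
      · rintro ⟨h1, h2⟩
        have h3 := mat_mul_mat_inv (φ l)
        rw [h1, Matrix.one_mul] at h3
        exact ⟨h3, by simpa [vec_inv, h3] using h2⟩
    have hzero : φ l ∈ ({trans (Pi.single i c)} * hyperplane G i : Set (NaturalSemidirectProduct n G))
        ↔ mat (φ l) = 1 ∧ vec (φ l) i = c := by
      rw [singleton_mul, mem_image]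
      constructor
      · rintro ⟨q, ⟨hq, hqi⟩, hl⟩
        rw [← hl]
        simp [hq, hqi]
      · rintro ⟨h1, h2⟩
        refine ⟨(trans (Pi.single i c))⁻¹ * φ l, ⟨?_, ?_⟩, by simp⟩
        · have h3 := mat_mul_mat_inv (trans (Pi.single i c) : NaturalSemidirectProduct n G)
          rw [mat_trans, Matrix.one_mul] at h3
          simp [h1, h3]
        · have h3 := mat_mul_mat_inv (trans (Pi.single i c) : NaturalSemidirectProduct n G)
          rw [mat_trans, Matrix.one_mul] at h3
          simp [h2, h3, vec_inv]
    simp only [mem_union, hneg, mem_preimage, hzero, mem_compl_iff]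
    simp only [halfSpace, translations, mem_ofPred_eq, ← and_or_left, ← le_iff_lt_or_eq, not_and,
      not_lt]
    tauto
  rw [h]
  refine ((isClosed_preimage_translations φ).isOpen_compl.measurableSet.analyticSet).union
    (((analyticSet_preimage_halfSpace φ hn hG i (-c)).image_of_continuous continuous_inv).union ?_)
  rw [φ.preimage_mul_set]
  exact (φ.analyticSet_preimage_singleton _).mul
    (isClosed_preimage_hyperplane φ hn hG i).analyticSet

theorem analyticSet_preimage_linearPart (hn : 2 ≤ n) (hG : specialLinearSubgroup n ≤ G) :
    AnalyticSet (φ ⁻¹' linearPart n G) := by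
  rw [linearPart_eq_closure hG, φ.preimage_submonoid_closure, preimage_union]
  refine ((isClosed_preimage_torus φ hn hG).analyticSet.union ?_).submonoid_closure
  exact ((finite_range _).preimage φ.injective.injOn).isClosed.analyticSet

theorem measurable_vec_apply [MeasurableSpace L] [BorelSpace L] (hn : 2 ≤ n)
    (hG : specialLinearSubgroup n ≤ G) (i : Fin n) : Measurable fun l => vec (φ l) i := by
  -- Every element is a translation times a linear map. Applied to `Ioi c` and `Iic c`, this makes
  -- both a set and its complement analytic.
  have key : ∀ s : Set ℝ, {p : NaturalSemidirectProduct n G | vec p i ∈ s} =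
      {p | mat p = 1 ∧ vec p i ∈ s} * linearPart n G := by
    intro s
    ext p
    constructor
    · intro hp
      exact ⟨trans (vec p), ⟨rfl, hp⟩, (trans (vec p))⁻¹ * p,
        by simp [linearPart, vec_inv], by simp⟩
    · rintro ⟨q, ⟨hq, hqs⟩, r, hr, rfl⟩
      have hr : vec r = 0 := hr
      simpa [hr] using hqs
  have hH := analyticSet_preimage_linearPart φ hn hG
  have hm := measurableSet_preimage_halfSpace φ hn hG i
  refine measurable_of_Ioi fun c => AnalyticSet.measurableSet_of_compl ?_ ?_
  · have h := (hm c).analyticSet.mul hH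
    rw [← φ.preimage_mul_set] at h
    change AnalyticSet (φ ⁻¹' {p | vec p i ∈ Ioi c})
    rw [key]
    exact h
  · have h := (((isClosed_preimage_translations φ).measurableSet.diff (hm c)).analyticSet).mul hH
    rw [← preimage_sdiff, ← φ.preimage_mul_set] at h
    have h1 : translations n G \ halfSpace G i c = {p | mat p = 1 ∧ vec p i ∈ Iic c} := by
      ext p
      simp only [translations, halfSpace, mem_sdiff, mem_ofPred_eq, mem_Iic, not_and, not_lt]
      tauto
    rw [← preimage_compl, compl_Ioi]
    change AnalyticSet (φ ⁻¹' {p | vec p i ∈ Iic c})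
    rw [key, ← h1]
    exact h

/-- Conjugating the `j`-th basis translation gives translation by the `j`-th column, and conjugation
is continuous in `L`. -/
theorem measurable_mat_apply [MeasurableSpace L] [BorelSpace L] (hn : 2 ≤ n)
    (hG : specialLinearSubgroup n ≤ G) (i j : Fin n) : Measurable fun l => mat (φ l) i j := by
  refine measurable_of_Ioi fun c => ?_
  have h : (fun l => mat (φ l) i j) ⁻¹' Ioi c =
      (fun l => l * φ.symm (trans (Pi.single j 1)) * l⁻¹) ⁻¹' (φ ⁻¹' halfSpace G i c) := by
    ext l
    simp [halfSpace, conj_trans]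
  rw [h]
  have hc : Continuous fun l => l * φ.symm (trans (Pi.single j 1)) * l⁻¹ := by fun_prop
  exact hc.measurable (measurableSet_preimage_halfSpace φ hn hG i c)

end Borel

/-! ### Topology of ℝⁿ ⋊ G. -/

variable (n G) in
/-- The semidirect product is homeomorphic to the product. -/
def homeomorphProd : NaturalSemidirectProduct n G ≃ₜ Multiplicative (Fin n → ℝ) × G :=
  SemidirectProduct.equivProd.toHomeomorphOfIsInducing ⟨rfl⟩

/-- The inverse matrix appears because the topology of a unit group is induced by a unit together
with its inverse. -/
theorem isInducing_coordinates : IsInducing fun p : NaturalSemidirectProduct n G =>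
    (vec p, (fun i j => mat p i j : Fin n → Fin n → ℝ),
      (fun i j => mat p⁻¹ i j : Fin n → Fin n → ℝ)) := by
  have h1 : IsInducing fun A : G => Units.embedProduct _ A.1 :=
    Units.isEmbedding_embedProduct.isInducing.comp IsInducing.subtypeVal
  have h2 := (IsInducing.id.prodMap MulOpposite.opHomeomorph.symm.isInducing).comp h1
  have h3 : IsInducing (Multiplicative.toAdd : Multiplicative (Fin n → ℝ) → Fin n → ℝ) :=
    ⟨induced_id.symm⟩
  exact (h3.prodMap h2).comp (homeomorphProd n G).isInducing

theorem measurable_of_coordinates {X : Type*} [MeasurableSpace X]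
    [MeasurableSpace (NaturalSemidirectProduct n G)] [BorelSpace (NaturalSemidirectProduct n G)]
    {f : X → NaturalSemidirectProduct n G} (h1 : Measurable fun x => vec (f x))
    (h2 : ∀ i j, Measurable fun x => mat (f x) i j)
    (h3 : ∀ i j, Measurable fun x => mat (f x)⁻¹ i j) : Measurable f := by
  rw [BorelSpace.measurable_eq (α := NaturalSemidirectProduct n G), isInducing_coordinates.eq_induced,
    borel_comap, measurable_comap_iff, ← BorelSpace.measurable_eq]
  exact h1.prodMk ((measurable_pi_lambda _ fun i => measurable_pi_lambda _ (h2 i)).prodMk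
    (measurable_pi_lambda _ fun i => measurable_pi_lambda _ (h3 i)))

theorem continuous_vec : Continuous (vec : NaturalSemidirectProduct n G → Fin n → ℝ) :=
  isInducing_coordinates.continuous.fst

theorem continuous_mat :
    Continuous (mat : NaturalSemidirectProduct n G → Matrix (Fin n) (Fin n) ℝ) :=
  isInducing_coordinates.continuous.snd.fst

theorem continuous_mat_inv :
    Continuous fun p : NaturalSemidirectProduct n G => mat p⁻¹ :=
  isInducing_coordinates.continuous.snd.snd

instance isTopologicalGroup : IsTopologicalGroup (NaturalSemidirectProduct n G) where
  continuous_mul := by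
    refine isInducing_coordinates.continuous_iff.2 ?_
    have hv := continuous_vec (n := n) (G := G)
    have hm := continuous_mat (n := n) (G := G)
    have hi := continuous_mat_inv (n := n) (G := G)
    refine .prodMk ?_ (.prodMk ?_ ?_)
    · exact (hv.comp continuous_fst).add
        ((hm.comp continuous_fst).matrix_mulVec (hv.comp continuous_snd))
    · exact (hm.comp continuous_fst).matrix_mul (hm.comp continuous_snd)
    · simp only [_root_.mul_inv_rev, mat_mul]
      exact (hi.comp continuous_snd).matrix_mul (hi.comp continuous_fst)
  continuous_inv := by
    refine isInducing_coordinates.continuous_iff.2 (.prodMk ?_ (.prodMk continuous_mat_inv ?_))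
    · simp only [vec_inv]
      exact (continuous_mat_inv.matrix_mulVec continuous_vec).neg
    · simp only [inv_inv]
      exact continuous_mat

theorem polishSpace (hG : IsClosed (G : Set (GL (Fin n) ℝ))) :
    PolishSpace (NaturalSemidirectProduct n G) := by
  have h1 : PolishSpace (Matrix (Fin n) (Fin n) ℝ) :=
    inferInstanceAs (PolishSpace (Fin n → Fin n → ℝ))
  have h2 : PolishSpace (Matrix (Fin n) (Fin n) ℝ)ᵐᵒᵖ :=
    MulOpposite.opHomeomorph.symm.isClosedEmbedding.polishSpace
  have h3 : PolishSpace (GL (Fin n) ℝ) := Units.isClosedEmbedding_embedProduct.polishSpace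
  have h4 : PolishSpace G := hG.polishSpace
  have h5 : PolishSpace (Multiplicative (Fin n → ℝ)) := inferInstanceAs (PolishSpace (Fin n → ℝ))
  exact (homeomorphProd n G).isClosedEmbedding.polishSpace

theorem locallyCompactSpace (hG : IsClosed (G : Set (GL (Fin n) ℝ))) :
    LocallyCompactSpace (NaturalSemidirectProduct n G) := by
  have h1 : LocallyCompactSpace (Matrix (Fin n) (Fin n) ℝ) :=
    inferInstanceAs (LocallyCompactSpace (Fin n → Fin n → ℝ))
  have h3 : LocallyCompactSpace (GL (Fin n) ℝ) :=
    Units.isClosedEmbedding_embedProduct.locallyCompactSpace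
  have h4 : LocallyCompactSpace G := hG.isClosedEmbedding_subtypeVal.locallyCompactSpace
  have h5 : LocallyCompactSpace (Multiplicative (Fin n → ℝ)) :=
    inferInstanceAs (LocallyCompactSpace (Fin n → ℝ))
  exact (homeomorphProd n G).isClosedEmbedding.locallyCompactSpace

theorem isHomeomorph (hn : 2 ≤ n) (hG : specialLinearSubgroup n ≤ G)
    (hG' : IsClosed (G : Set (GL (Fin n) ℝ))) {L : Type*} [Group L] [TopologicalSpace L]
    (hL : IsPolishGroup L) (φ : L ≃* NaturalSemidirectProduct n G) : IsHomeomorph φ := by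
  have := hL.isTopologicalGroup
  have := hL.polishSpace
  have := polishSpace hG'
  have := locallyCompactSpace hG'
  borelize L (NaturalSemidirectProduct n G)
  refine φ.isHomeomorph_of_measurable (measurable_of_coordinates ?_ ?_ ?_)
  · exact measurable_pi_lambda _ fun i => measurable_vec_apply φ hn hG i
  · exact measurable_mat_apply φ hn hG
  · intro i j
    simp only [← map_inv]
    exact (measurable_mat_apply φ hn hG i j).comp measurable_inv

end NaturalSemidirectProduct

theorem isClosed_setOf_det_mem (n : ℕ) {s : Set ℝ} (hs : IsClosed s) :
    IsClosed {A : GL (Fin n) ℝ | (A : Matrix (Fin n) (Fin n) ℝ).det ∈ s} :=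
  hs.preimage Units.continuous_val.matrix_det

end

theorem mainTheorem1 (n : ℕ) (hn : 2 ≤ n) (G : Subgroup (GL (Fin n) ℝ))
    (hG : G = ⊤ ∨ G = specialLinearSubgroup n ∨ G = absSpecialLinearSubgroup n ∨
      G = Matrix.GLPos (Fin n) ℝ) :
    (∀ (L : Type u) [Group L] [TopologicalSpace L], IsPolishGroup L →
      ∀ φ : L ≃* NaturalSemidirectProduct n G, IsHomeomorph φ) ∧
    IsAlgebraicallyDetermined.{u, 0} (NaturalSemidirectProduct n G) := by
  have hSL : specialLinearSubgroup n ≤ G := by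
    rcases hG with rfl | rfl | rfl | rfl
    · exact le_top
    · exact le_rfl
    · intro A (hA : det A.1 = 1)
      change |det A.1| = 1
      rw [hA, abs_one]
    · intro A (hA : det A.1 = 1)
      rw [mem_glpos, GeneralLinearGroup.val_det_apply, hA]
      exact one_pos
  have hcl : IsClosed (G : Set (GL (Fin n) ℝ)) := by
    rcases hG with rfl | rfl | rfl | rfl
    · exact isClosed_univ
    · exact isClosed_setOf_det_mem n isClosed_singleton
    · exact isClosed_setOf_det_mem n (isClosed_singleton.preimage continuous_abs)
    -- Determinants in `GL` are nonzero, so positivity is the closed condition of being nonnegative.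
    · convert isClosed_setOf_det_mem n (isClosed_Ici (a := (0 : ℝ))) using 1
      ext A
      exact ⟨fun h : 0 < det A.1 => h.le, fun h : 0 ≤ det A.1 => lt_of_le_of_ne h A.det.ne_zero.symm⟩
  have main : ∀ (L : Type u) [Group L] [TopologicalSpace L], IsPolishGroup L →
      ∀ φ : L ≃* NaturalSemidirectProduct n G, IsHomeomorph φ :=
    fun L _ _ hL φ => NaturalSemidirectProduct.isHomeomorph hn hSL hcl hL φ
  exact ⟨main, ⟨inferInstance, NaturalSemidirectProduct.polishSpace hcl⟩, main⟩
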